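/- Let $M$ be a smooth manifold of dimension $n$, and let $F:TM\to[0,\infty)$ be a Finsler structure: $F$ is smooth on $TM\setminus 0$, $F(x,\lambda y)=\lambda F(x,y)$ for $\lambda>0$, and $g_{ij}=\tfrac12\,\partial^2(F^2)/\partial y^i\partial y^j$ is positive definite on $TM\setminus0$. In local coordinates $(x^i,y^i)$ induced by a chart of $M$, with indices raised and lowered by $g$, put $A_{ijk}=\tfrac F2\,\partial g_{ij}/\partial y^k$, $\omega_i=\partial F/\partial y^i$, and $$N^k_m=\tfrac14\,\frac{\partial}{\partial y^m}\Big(g^{ks}\big(\tfrac{\partial g_{si}}{\partial x^j}+\tfrac{\partial g_{sj}}{\partial x^i}-\tfrac{\partial g_{ij}}{\partial x^s}\big)y^iy^j\Big).$$ The Chern connection $D$ and the Berwald connection ${}^\flat D$ on the pulled-back tangent bundle $\pi^*(TM)\to TM\setminus0$ have the Christoffel symbols $$\gamma^k_{ij}=\tfrac12g^{ks}\big(\tfrac{\partial g_{si}}{\partial x^j}+\tfrac{\partial g_{sj}}{\partial x^i}-\tfrac{\partial g_{ij}}{\partial x^s}\big)-g^{ks}\big(\tfrac{N^m_j}{F}A_{msi}+\tfrac{N^m_i}{F}A_{msj}-\tfrac{N^m_s}{F}A_{mij}\big),\qquad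 {}^\flat\gamma^k_{ij}=\frac{\partial N^k_i}{\partial y^j}.$$ Let $d_r=u\circ d$, where $u:T^*(TM\setminus0)\to\pi^*(T^*M)$ is a bundle map of the form $u=a\,h+b\,v$; here $a,b$ are functions on $TM$, $h(\theta)_r=\theta(\partial_{x^r}-N^m_r\partial_{y^m})$ is the horizontal projection, and $v(\theta)_r=\theta(\partial_{y^r})$ is the dual of the vertical lift (so $u=h$ and $u=v$ are included). Put $$B^k_{ij}=\big(A^{kr}_i\omega_j+A^{kr}_j\omega_i-A^k_{ij}\omega^r-A^r_{ij}\omega^k-A^k_{is}A^{sr}_j-A^k_{js}A^{sr}_i+A^{rk}_sA^s_{ij}\big)\,d_r(\log F),$$ $${}^\flat B^k_{ij}=\Big(F\,\frac{\partial A^{kr}_i}{\partial y^j}+A^{kr}_i\omega_j+2A^{rk}_j\omega_i\Big)\,d_r(\log F).$$ For $f\in\mathrm{Diff}(M)$ let $f^\ast$ denote the ordinary pull-back by $f$ of tensors, connections and operators (through the lift $Tf$ for objects on $TM\setminus0$), let $\ell(f)=f^\ast\gamma-\gamma$, and let $\mathrm{Sym}_{i,j}$ denote the sum over the two orderings of $i,j$.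 For $\delta\in\mathbb R$ let $\mathcal A(f)$ be the operator that sends a symmetric twice contravariant tensor density $P$ of weight $\delta$ on $M$ to the section $\mathcal A(f)^k_{ij}P^{ij}$ of $\pi^*(TM)$ with values in the $\delta$-densities of $\pi^*(T^*M)$, where $$\begin{aligned}\mathcal A(f)^k_{ij}={}&f^\ast\big(g^{sk}g_{ij}D_s\big)-g^{sk}g_{ij}D_s+(2-\delta n)\Big(\ell(f)^k_{ij}-\tfrac1n\mathrm{Sym}_{i,j}\,\delta^k_i\,\ell(f)^t_{tj}\Big)\\&+W^k_{ij}-f^\ast W^k_{ij}-(2-\delta n)\Big(f^\ast B^k_{ij}-B^k_{ij}-\tfrac1n\mathrm{Sym}_{i,j}\,\delta^k_i\big(f^\ast B^t_{jt}-B^t_{jt}\big)\Big),\\W^k_{ij}={}&g^{kl}\big(\mathrm{Sym}_{i,j}\,g_{sj}B^s_{li}-\delta\,g_{ij}B^t_{lt}\big),\end{aligned}$$ and $D_sP^{ij}=\partial_{x^s}P^{ij}+\gamma^i_{sm}P^{mj}+\gamma^j_{sm}P^{im}-\delta\,\gamma^t_{ts}P^{ij}$. Let ${}^\flat\!\mathcal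 A(f)$ be the operator given by the same formulas with $\gamma,D,B$ replaced by ${}^\flat\gamma,{}^\flat D,{}^\flat B$. If $(M,F)$ is a Landsberg space, i.e. if the tensor $\dot A_{ijk}=-\tfrac12\,y_l\,\dfrac{\partial^2N^l_i}{\partial y^j\partial y^k}$ vanishes identically on $TM\setminus 0$, where $y_l=g_{lm}y^m$, then $\mathcal A(f)={}^\flat\!\mathcal A(f)$ for every $f\in\mathrm{Diff}(M)$ and every $\delta\in\mathbb R$. -/

import Mathlib

open scoped Manifold ContDiff

noncomputable section

namespace Finsler

/-! ### Coordinate calculus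

A point of the coordinate domain of `TM` is a pair `p = (x, y)` of vectors of `ℝⁿ`; `L` denotes the
coordinate expression of the Finsler function. Index conventions: the arguments `k i j` of symbols
such as `Γ L p k i j` stand for `Γ^k_{ij}` at `p`. -/

/-- The coordinate space `ℝⁿ`. -/
abbrev E (n : ℕ) : Type := EuclideanSpace ℝ (Fin n)

variable {n : ℕ}

/-- The standard basis vector `e_i` of `ℝⁿ`. -/
def e (i : Fin n) : E n := EuclideanSpace.single i (1 : ℝ)

/-- `∂h/∂x^i`. -/
def dx (i : Fin n) (h : E n × E n → ℝ) (p : E n × E n) : ℝ := fderiv ℝ h p (e i, 0)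

/-- `∂h/∂y^i`. -/
def dy (i : Fin n) (h : E n × E n → ℝ) (p : E n × E n) : ℝ := fderiv ℝ h p (0, e i)

/-- The Kronecker symbol. -/
def kron (i k : Fin n) : ℝ := if i = k then 1 else 0

/-- The fundamental tensor `g_{ij} = ½ ∂²(L²)/∂y^i∂y^j`, as a matrix. -/
def g (L : E n × E n → ℝ) (p : E n × E n) : Matrix (Fin n) (Fin n) ℝ :=
  Matrix.of fun i j => (1 / 2 : ℝ) * dy i (dy j fun q => L q ^ 2) p

/-- The inverse fundamental tensor `g^{ij}`. -/
def gInv (L : E n × E n → ℝ) (p : E n × E n) : Matrix (Fin n) (Fin n) ℝ := (g L p)⁻¹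

/-- The Cartan tensor `A_{ijk} = (L/2) ∂g_{ij}/∂y^k`. -/
def cartan (L : E n × E n → ℝ) (p : E n × E n) (i j k : Fin n) : ℝ :=
  L p / 2 * dy k (fun q => g L q i j) p

/-- `A^k_{ij} = A_{ijl} g^{lk}`. -/
def cartanUp (L : E n × E n → ℝ) (p : E n × E n) (k i j : Fin n) : ℝ :=
  ∑ l, cartan L p i j l * gInv L p l k

/-- `A^{kr}_i = A_{iab} g^{ak} g^{br}`. -/
def cartanUpUp (L : E n × E n → ℝ) (p : E n × E n) (k r i : Fin n) : ℝ :=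
  ∑ a, ∑ b, cartan L p i a b * gInv L p a k * gInv L p b r

/-- The Hilbert form `ω_i = ∂L/∂y^i`. -/
def hilbert (L : E n × E n → ℝ) (p : E n × E n) (i : Fin n) : ℝ := dy i L p

/-- `ω^k = g^{kl} ω_l`. -/
def hilbertUp (L : E n × E n → ℝ) (p : E n × E n) (k : Fin n) : ℝ :=
  ∑ l, gInv L p k l * hilbert L p l

/-- `∂g_{si}/∂x^j + ∂g_{sj}/∂x^i - ∂g_{ij}/∂x^s`. -/
def firstKind (L : E n × E n → ℝ) (p : E n × E n) (s i j : Fin n) : ℝ :=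
  dx j (fun q => g L q s i) p + dx i (fun q => g L q s j) p - dx s (fun q => g L q i j) p

/-- The nonlinear connection `N^k_m`. -/
def nonlin (L : E n × E n → ℝ) (p : E n × E n) (k m : Fin n) : ℝ :=
  (1 / 4 : ℝ) *
    dy m (fun q => ∑ s, ∑ i, ∑ j, gInv L q k s * firstKind L q s i j * q.2 j * q.2 i) p

/-- The Christoffel symbols `γ^k_{ij}` of the Chern connection. -/
def chern (L : E n × E n → ℝ) (p : E n × E n) (k i j : Fin n) : ℝ :=
  (1 / 2 : ℝ) * ∑ s, gInv L p k s * firstKind L p s i j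
    - ∑ s, gInv L p k s * ∑ m,
        (nonlin L p m j / L p * cartan L p m s i + nonlin L p m i / L p * cartan L p m s j
          - nonlin L p m s / L p * cartan L p m i j)

/-- The Christoffel symbols `♭γ^k_{ij} = ∂N^k_i/∂y^j` of the Berwald connection. -/
def berwald (L : E n × E n → ℝ) (p : E n × E n) (k i j : Fin n) : ℝ :=
  dy j (fun q => nonlin L q k i) p

/-- The Landsberg tensor `Ȧ_{ijk} = -½ y_l ∂²N^l_i/∂y^j∂y^k`, where `y_l = g_{lm} y^m`. -/
def landsberg (L : E n × E n → ℝ) (p : E n × E n) (i j k : Fin n) : ℝ :=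
  -(1 / 2 : ℝ) * ∑ l, (∑ m, g L p l m * p.2 m) * dy j (dy k fun q => nonlin L q l i) p

/-- The bundle map `u = a h + b v : T^*(TM∖0) → π^*(T^*M)`, in coordinates. Here `h` is the projection
onto the horizontal part, `h(θ)_r = θ(∂/∂x^r - N^m_r ∂/∂y^m)`, and `v` is the dual of the vertical
lift, `v(θ)_r = θ(∂/∂y^r)`. -/
def uMap (L a b : E n × E n → ℝ) (p : E n × E n) (θ : E n × E n →L[ℝ] ℝ) (r : Fin n) : ℝ :=
  a p * (θ (e r, 0) - ∑ m, nonlin L p m r * θ (0, e m)) + b p * θ (0, e r)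

/-- `d_r (log L)`, where `d_r = u ∘ d`. -/
def dLog (L a b : E n × E n → ℝ) (p : E n × E n) (r : Fin n) : ℝ :=
  uMap L a b p (fderiv ℝ (fun q => Real.log (L q)) p) r

/-- The tensor `B^k_{ij}` that goes with the Chern connection. -/
def chernB (L a b : E n × E n → ℝ) (p : E n × E n) (k i j : Fin n) : ℝ :=
  ∑ r, (cartanUpUp L p k r i * hilbert L p j + cartanUpUp L p k r j * hilbert L p i
      - cartanUp L p k i j * hilbertUp L p r - cartanUp L p r i j * hilbertUp L p k
      - ∑ s, cartanUp L p k i s * cartanUpUp L p s r j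
      - ∑ s, cartanUp L p k j s * cartanUpUp L p s r i
      + ∑ s, cartanUpUp L p r k s * cartanUp L p s i j) * dLog L a b p r

/-- The tensor `♭B^k_{ij}` that goes with the Berwald connection. The connection forms of the Berwald
connection have no `dy` part, so that `♭D_{\bar j} = ∂/∂y^j` on components. -/
def berwaldB (L a b : E n × E n → ℝ) (p : E n × E n) (k i j : Fin n) : ℝ :=
  ∑ r, (dy j (fun q => cartanUpUp L q k r i) p * L p + cartanUpUp L p k r i * hilbert L p j
      + 2 * cartanUpUp L p r k j * hilbert L p i) * dLog L a b p r

/-- The covariant derivative `D_s P^{ij}` of a twice contravariant tensor density of weight `δ`, at a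
point at which the Christoffel symbols of the connection are `Γ`. -/
def covDeriv (δ : ℝ) (Γ : Fin n → Fin n → Fin n → ℝ) (P : E n → Fin n → Fin n → ℝ) (x : E n)
    (s i j : Fin n) : ℝ :=
  fderiv ℝ (fun z => P z i j) x (e s) + ∑ m, (Γ i s m * P x m j + Γ j s m * P x i m)
    - δ * (∑ t, Γ t t s) * P x i j

/-! ### Geometric objects on a manifold, given by their components in all charts -/

variable {M : Type*} [TopologicalSpace M] [ChartedSpace (E n) M]

/-- The point of `TM` whose coordinates induced by the chart `φ` are `(x, y)`. -/
def lift (φ : OpenPartialHomeomorph M (E n)) (p : E n × E n) : TangentBundle (𝓡 n) M :=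
  tangentMap (𝓡 n) (𝓡 n) φ.symm ⟨p.1, p.2⟩

/-- The coordinate expression in the chart `φ` of a function on `TM`. -/
def local_ (F : TangentBundle (𝓡 n) M → ℝ) (φ : OpenPartialHomeomorph M (E n)) :
    E n × E n → ℝ :=
  fun p => F (lift φ p)

/-- `F : TM → [0, ∞)` is a Finsler structure on `M`. -/
structure IsFinsler [IsManifold (𝓡 n) ∞ M] (F : TangentBundle (𝓡 n) M → ℝ) : Prop where
  nonneg : ∀ v, 0 ≤ F v
  smooth : ContMDiffOn (𝓡 n).tangent 𝓘(ℝ, ℝ) ∞ F {v | v.2 ≠ 0}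
  homogeneous : ∀ (x : M) (y : TangentSpace (𝓡 n) x) (c : ℝ), 0 < c →
    F ⟨x, c • y⟩ = c * F ⟨x, y⟩
  posDef : ∀ φ ∈ IsManifold.maximalAtlas (𝓡 n) ∞ M, ∀ x ∈ φ.target, ∀ y : E n, y ≠ 0 →
    (g (local_ F φ) (x, y)).PosDef

/-- `(M, F)` is a Landsberg space. -/
def IsLandsberg (F : TangentBundle (𝓡 n) M → ℝ) : Prop :=
  ∀ φ ∈ IsManifold.maximalAtlas (𝓡 n) ∞ M, ∀ x ∈ φ.target, ∀ y : E n, y ≠ 0 →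
    ∀ i j k, landsberg (local_ F φ) (x, y) i j k = 0

/-- The Jacobian matrix at `x` of the coordinate change from `φ` to `ψ`. -/
def jacobian (φ ψ : OpenPartialHomeomorph M (E n)) (x : E n) : Matrix (Fin n) (Fin n) ℝ :=
  Matrix.of fun i k => fderiv ℝ (fun z => ψ (φ.symm z)) x (e k) i

/-- `P φ x i j` are the components in the charts `φ` of a smooth symmetric twice contravariant tensor
density of weight `δ` on `M`, a section of `S²TM ⊗ |Λⁿ T^*M|^δ`. -/
structure IsSymTensorDensity (δ : ℝ)
    (P : OpenPartialHomeomorph M (E n) → E n → Fin n → Fin n → ℝ) : Prop where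
  smooth : ∀ φ ∈ IsManifold.maximalAtlas (𝓡 n) ∞ M, ∀ i j,
    ContDiffOn ℝ ∞ (fun x => P φ x i j) φ.target
  symm : ∀ φ ∈ IsManifold.maximalAtlas (𝓡 n) ∞ M, ∀ x ∈ φ.target, ∀ i j, P φ x i j = P φ x j i
  transform : ∀ φ ∈ IsManifold.maximalAtlas (𝓡 n) ∞ M,
    ∀ ψ ∈ IsManifold.maximalAtlas (𝓡 n) ∞ M, ∀ x ∈ φ.target, φ.symm x ∈ ψ.source →
    ∀ i j, P ψ (ψ (φ.symm x)) i j = |(jacobian φ ψ x).det| ^ (-δ) *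
      ∑ k, ∑ l, jacobian φ ψ x i k * jacobian φ ψ x j l * P φ x k l

/-- The pull-back by a diffeomorphism `f` of a geometric object on `M`, `TM` or `TM∖0` given by its
components in all charts: the components of the pulled-back object in the chart `φ` at a point are the
components of the object in the chart `φ ∘ f⁻¹` at the image point. The coordinates of a point with
respect to `φ` are those of its image under `f` (under `Tf`, for tangent vectors) with respect to
`φ ∘ f⁻¹`. -/
def pullback {α : Type*} (f : M ≃ₘ^∞⟮𝓡 n, 𝓡 n⟯ M) (O : OpenPartialHomeomorph M (E n) → α) :
    OpenPartialHomeomorph M (E n) → α :=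
  fun φ => O (f.symm.toHomeomorph.toOpenPartialHomeomorph.trans φ)

/-- The pull-back by `f` of an operator: push the argument forward by `f`, apply the operator, and
pull the result back by `f`. -/
def pullbackOp {α β : Type*} (f : M ≃ₘ^∞⟮𝓡 n, 𝓡 n⟯ M)
    (X : (OpenPartialHomeomorph M (E n) → α) → OpenPartialHomeomorph M (E n) → β) :
    (OpenPartialHomeomorph M (E n) → α) → OpenPartialHomeomorph M (E n) → β :=
  fun P => pullback f (X (pullback f.symm P))

/-- The operator `P ↦ g^{sk} g_{ij} D_s P^{ij}` for the connection with Christoffel symbols `Γ`. -/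
def divOp (F : TangentBundle (𝓡 n) M → ℝ) (δ : ℝ)
    (Γ : OpenPartialHomeomorph M (E n) → E n × E n → Fin n → Fin n → Fin n → ℝ)
    (P : OpenPartialHomeomorph M (E n) → E n → Fin n → Fin n → ℝ) :
    OpenPartialHomeomorph M (E n) → E n × E n → Fin n → ℝ :=
  fun φ p k => ∑ s, ∑ i, ∑ j, gInv (local_ F φ) p s k * g (local_ F φ) p i j *
    covDeriv δ (Γ φ p) (P φ) p.1 s i j

/-- `g^{kl} (Sym_{i,j} g_{sj} B^s_{li} - δ g_{ij} B^t_{lt})`. -/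
def correction (F : TangentBundle (𝓡 n) M → ℝ) (δ : ℝ)
    (B : OpenPartialHomeomorph M (E n) → E n × E n → Fin n → Fin n → Fin n → ℝ) :
    OpenPartialHomeomorph M (E n) → E n × E n → Fin n → Fin n → Fin n → ℝ :=
  fun φ p k i j => ∑ l, gInv (local_ F φ) p k l *
    ((∑ s, (g (local_ F φ) p s j * B φ p s l i + g (local_ F φ) p s i * B φ p s l j))
      - δ * g (local_ F φ) p i j * ∑ t, B φ p t l t)

/-- The operator `𝒜(f)` built from the connection with Christoffel symbols `Γ` and from the tensor `B`:
it sends a symmetric tensor density `P` of weight `δ` on `M` to `𝒜(f)^k_{ij} P^{ij}`, a section of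
`π^*(TM)` with values in the `δ`-densities of `π^*(T^*M)`, in components. `Sym_{i,j}` is the sum over
the two orderings of `i, j`. -/
def cocycleOp (F : TangentBundle (𝓡 n) M → ℝ) (δ : ℝ)
    (Γ B : OpenPartialHomeomorph M (E n) → E n × E n → Fin n → Fin n → Fin n → ℝ)
    (f : M ≃ₘ^∞⟮𝓡 n, 𝓡 n⟯ M)
    (P : OpenPartialHomeomorph M (E n) → E n → Fin n → Fin n → ℝ) :
    OpenPartialHomeomorph M (E n) → E n × E n → Fin n → ℝ :=
  fun φ p k =>
    let ℓ := fun k i j => pullback f Γ φ p k i j - Γ φ p k i j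
    let ΔB := fun k i j => pullback f B φ p k i j - B φ p k i j
    pullbackOp f (divOp F δ Γ) P φ p k - divOp F δ Γ P φ p k
      + ∑ i, ∑ j,
        ((2 - δ * n) * (ℓ k i j
            - (1 / n : ℝ) * (kron i k * ∑ t, ℓ t t j + kron j k * ∑ t, ℓ t t i))
          + (correction F δ B φ p k i j - pullback f (correction F δ B) φ p k i j)
          - (2 - δ * n) * (ΔB k i j
            - (1 / n : ℝ) * (kron i k * ∑ t, ΔB t j t + kron j k * ∑ t, ΔB t i t)))
        * P φ p.1 i j

/-- The operator `𝒜(f)`, built from the Chern connection; the functions `a`, `b` on `TM` determine the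
bundle map `u = a h + b v`. -/
def chernOp (F a b : TangentBundle (𝓡 n) M → ℝ) (δ : ℝ) (f : M ≃ₘ^∞⟮𝓡 n, 𝓡 n⟯ M)
    (P : OpenPartialHomeomorph M (E n) → E n → Fin n → Fin n → ℝ) :
    OpenPartialHomeomorph M (E n) → E n × E n → Fin n → ℝ :=
  cocycleOp F δ (fun φ => chern (local_ F φ))
    (fun φ => chernB (local_ F φ) (local_ a φ) (local_ b φ)) f P

/-- The operator `♭𝒜(f)`, built from the Berwald connection. -/
def berwaldOp (F a b : TangentBundle (𝓡 n) M → ℝ) (δ : ℝ) (f : M ≃ₘ^∞⟮𝓡 n, 𝓡 n⟯ M)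
    (P : OpenPartialHomeomorph M (E n) → E n → Fin n → Fin n → ℝ) :
    OpenPartialHomeomorph M (E n) → E n × E n → Fin n → ℝ :=
  cocycleOp F δ (fun φ => berwald (local_ F φ))
    (fun φ => berwaldB (local_ F φ) (local_ a φ) (local_ b φ)) f P

end Finsler

end

noncomputable section

namespace Finsler

variable {n : ℕ}

/-! ### Calculus of partial derivatives on an open set -/

section Calculus

variable {V : Type*} [NormedAddCommGroup V] [NormedSpace ℝ V] {Ω : Set V} {h k : V → ℝ}

/-! `𝒜(f)` sees the connection and the tensor `B` only through their components at a point and,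
after pull-back, through those in the chart `φ ∘ f⁻¹`. So it is enough that in every chart the two
sets of Christoffel symbols agree and the two tensors `B` agree.

Both facts rest on one identity: `F` is constant along horizontal directions, `∂F/∂x^r = N^k_r
∂F/∂y^k` (`dx_eq_sum_nonlin`), obtained by differentiating in `y` the invariance of `F²` under the
geodesic spray.

Connections: two further `y`-derivatives of this identity for `F²` express the horizontal Berwald
derivative of `g` as `-2Ȧ` (`dx_g_eq`). If `Ȧ = 0`, the Berwald connection is torsion-free and
horizontally metric, and the Christoffel trick identifies it with the Chern connection
(`chern_eq_berwald`).

Tensors: horizontal constancy reduces `d_r log F` to `(b/F) ω_r`. Since contracting `A` with `ω`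
gives zero and `ω^r ω_r = 1`, both tensors collapse to `-(b/F) A^k_{ij}`, on any Finsler space
(`chernB_eq`, `berwaldB_eq`). The Landsberg condition matters only for the connections. -/

theorem contDiffOn_fderiv_apply (hΩ : IsOpen Ω) (hh : ContDiffOn ℝ ∞ h Ω) (v : V) :
    ContDiffOn ℝ ∞ (fun p => fderiv ℝ h p v) Ω :=
  (hh.fderiv_of_isOpen hΩ (by simp)).clm_apply contDiffOn_const

theorem differentiableAt_of_contDiffOn (hΩ : IsOpen Ω) (hh : ContDiffOn ℝ ∞ h Ω) {p : V}
    (hp : p ∈ Ω) : DifferentiableAt ℝ h p :=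
  (hh.contDiffAt (hΩ.mem_nhds hp)).differentiableAt (by simp)

theorem fderiv_eq_of_eqOn (hΩ : IsOpen Ω) (hk : Set.EqOn h k Ω) {p : V} (hp : p ∈ Ω) :
    fderiv ℝ h p = fderiv ℝ k p :=
  (hk.eventuallyEq_of_mem (hΩ.mem_nhds hp)).fderiv_eq

theorem fderiv_fderiv_apply_comm (hΩ : IsOpen Ω) (hh : ContDiffOn ℝ ∞ h Ω) {p : V} (hp : p ∈ Ω)
    (v w : V) :
    fderiv ℝ (fun q => fderiv ℝ h q w) p v = fderiv ℝ (fun q => fderiv ℝ h q v) p w := by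
  have hs := (hh.contDiffAt (hΩ.mem_nhds hp)).isSymmSndFDerivAt
    (by simpa using ENat.LEInfty.out)
  have hd : DifferentiableAt ℝ (fderiv ℝ h) p :=
    ((hh.fderiv_of_isOpen hΩ (m := ∞) (by simp)).contDiffAt (hΩ.mem_nhds hp)).differentiableAt
      (by simp)
  rw [fderiv_clm_apply hd (by fun_prop), fderiv_clm_apply hd (by fun_prop)]
  simpa using hs.eq v w

/-- Cramer's rule: an entry of the inverse is a quotient of two determinants, which are polynomials
in the entries. -/
theorem contDiffOn_matrix_inv_apply {m : Type*} [Fintype m] [DecidableEq m]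
    {A : V → Matrix m m ℝ} (hA : ∀ i j, ContDiffOn ℝ ∞ (fun p => A p i j) Ω)
    (hdet : ∀ p ∈ Ω, (A p).det ≠ 0) (i j : m) :
    ContDiffOn ℝ ∞ (fun p => (A p)⁻¹ i j) Ω := by
  have hd : ∀ B : V → Matrix m m ℝ, (∀ i j, ContDiffOn ℝ ∞ (fun p => B p i j) Ω) →
      ContDiffOn ℝ ∞ (fun p => (B p).det) Ω := by
    intro B hB
    simp only [Matrix.det_apply']
    exact ContDiffOn.sum fun σ _ => contDiffOn_const.mul (contDiffOn_prod fun l _ => hB _ _)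
  have heq : (fun p => (A p)⁻¹ i j) =
      fun p => (A p).det⁻¹ * ((A p).updateRow j (Pi.single i 1)).det := by
    funext p
    simp [Matrix.inv_def, Matrix.adjugate_apply]
  rw [heq]
  refine ((hd A hA).inv hdet).mul (hd _ fun r s => ?_)
  by_cases hr : r = j
  · subst hr; simpa using contDiffOn_const
  · simpa [Matrix.updateRow_apply, hr] using hA r s

end Calculus

/-! ### Partial derivatives in the base and fibre coordinates -/

section Partial

variable {Ω : Set (E n × E n)} {h k : E n × E n → ℝ} {p : E n × E n}

theorem contDiffOn_dx (hΩ : IsOpen Ω) (hh : ContDiffOn ℝ ∞ h Ω) (i : Fin n) :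
    ContDiffOn ℝ ∞ (dx i h) Ω := contDiffOn_fderiv_apply hΩ hh _

theorem contDiffOn_dy (hΩ : IsOpen Ω) (hh : ContDiffOn ℝ ∞ h Ω) (i : Fin n) :
    ContDiffOn ℝ ∞ (dy i h) Ω := contDiffOn_fderiv_apply hΩ hh _

theorem contDiffOn_snd_apply (i : Fin n) : ContDiffOn ℝ ∞ (fun q : E n × E n => q.2 i) Ω := by
  fun_prop

theorem dx_congr (hΩ : IsOpen Ω) (hk : Set.EqOn h k Ω) (hp : p ∈ Ω) (i : Fin n) :
    dx i h p = dx i k p := by rw [dx, dx, fderiv_eq_of_eqOn hΩ hk hp]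

theorem dy_congr (hΩ : IsOpen Ω) (hk : Set.EqOn h k Ω) (hp : p ∈ Ω) (i : Fin n) :
    dy i h p = dy i k p := by rw [dy, dy, fderiv_eq_of_eqOn hΩ hk hp]

theorem dy_dy_comm (hΩ : IsOpen Ω) (hh : ContDiffOn ℝ ∞ h Ω) (hp : p ∈ Ω) (i j : Fin n) :
    dy i (dy j h) p = dy j (dy i h) p := fderiv_fderiv_apply_comm hΩ hh hp _ _

theorem dy_dx_comm (hΩ : IsOpen Ω) (hh : ContDiffOn ℝ ∞ h Ω) (hp : p ∈ Ω) (i j : Fin n) :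
    dy i (dx j h) p = dx j (dy i h) p := fderiv_fderiv_apply_comm hΩ hh hp _ _

theorem dx_mul (hh : DifferentiableAt ℝ h p) (hk : DifferentiableAt ℝ k p) (i : Fin n) :
    dx i (fun q => h q * k q) p = dx i h p * k p + h p * dx i k p := by
  simp only [dx, fderiv_fun_mul hh hk]
  simp; ring

theorem dy_mul (hh : DifferentiableAt ℝ h p) (hk : DifferentiableAt ℝ k p) (i : Fin n) :
    dy i (fun q => h q * k q) p = dy i h p * k p + h p * dy i k p := by
  simp only [dy, fderiv_fun_mul hh hk]
  simp; ring

theorem dx_sum {ι : Type*} {s : Finset ι} {H : ι → E n × E n → ℝ}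
    (hH : ∀ a ∈ s, DifferentiableAt ℝ (H a) p) (i : Fin n) :
    dx i (fun q => ∑ a ∈ s, H a q) p = ∑ a ∈ s, dx i (H a) p := by
  simp only [dx, fderiv_fun_sum hH]
  simp

theorem dy_sum {ι : Type*} {s : Finset ι} {H : ι → E n × E n → ℝ}
    (hH : ∀ a ∈ s, DifferentiableAt ℝ (H a) p) (i : Fin n) :
    dy i (fun q => ∑ a ∈ s, H a q) p = ∑ a ∈ s, dy i (H a) p := by
  simp only [dy, fderiv_fun_sum hH]
  simp

theorem dy_add (hh : DifferentiableAt ℝ h p) (hk : DifferentiableAt ℝ k p) (i : Fin n) :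
    dy i (fun q => h q + k q) p = dy i h p + dy i k p := by
  simp [dy, fderiv_fun_add hh hk]

theorem dx_const_mul (hh : DifferentiableAt ℝ h p) (c : ℝ) (i : Fin n) :
    dx i (fun q => c * h q) p = c * dx i h p := by
  simp [dx, fderiv_const_mul hh]

theorem dy_const_mul (hh : DifferentiableAt ℝ h p) (c : ℝ) (i : Fin n) :
    dy i (fun q => c * h q) p = c * dy i h p := by
  simp [dy, fderiv_const_mul hh]

theorem fderiv_snd_apply (j : Fin n) (v : E n × E n) :
    fderiv ℝ (fun q : E n × E n => q.2 j) p v = v.2 j := by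
  have : (fun q : E n × E n => q.2 j) =
      ((EuclideanSpace.proj j).comp (ContinuousLinearMap.snd ℝ (E n) (E n)) :
        E n × E n →L[ℝ] ℝ) := by
    funext q; rfl
  rw [this, ContinuousLinearMap.fderiv]; rfl

theorem dx_snd_apply (i j : Fin n) : dx i (fun q : E n × E n => q.2 j) p = 0 := by
  simp [dx, fderiv_snd_apply]

theorem dy_snd_apply (i j : Fin n) :
    dy i (fun q : E n × E n => q.2 j) p = if i = j then 1 else 0 := by
  simp [dy, fderiv_snd_apply, e, eq_comm]

/-- A covector of `ℝⁿ × ℝⁿ` evaluated on a vertical vector. -/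
theorem clm_apply_vertical (θ : E n × E n →L[ℝ] ℝ) (y : E n) :
    θ (0, y) = ∑ m, y m * θ (0, e m) := by
  have hy : ((0 : E n), y) = ∑ m, y m • ((0 : E n), e m) := by
    have : y = ∑ m, y m • (e m : E n) := by
      simpa [e] using ((EuclideanSpace.basisFun (Fin n) ℝ).sum_repr y).symm
    refine Prod.ext ?_ ?_
    · rw [Prod.fst_sum]; simp
    · rw [Prod.snd_sum]; simpa only [Prod.smul_snd] using this
  rw [hy]; simp only [map_sum, map_smul, smul_eq_mul]

/-- `∂/∂y^r` of a contraction with the fibre coordinates. -/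
theorem dy_sum_mul_snd {H : Fin n → E n × E n → ℝ} (hH : ∀ m, DifferentiableAt ℝ (H m) p)
    (r : Fin n) :
    dy r (fun q => ∑ m, H m q * q.2 m) p = ∑ m, dy r (H m) p * p.2 m + H r p := by
  have hs : ∀ m : Fin n, DifferentiableAt ℝ (fun q : E n × E n => q.2 m) p := fun m => by fun_prop
  rw [dy_sum fun m _ => (hH m).fun_mul (hs m)]
  simp only [dy_mul (hH _) (hs _), dy_snd_apply, Finset.sum_add_distrib]
  simp

/-- `∂/∂x^r` of a contraction with the fibre coordinates. -/
theorem dx_sum_mul_snd {H : Fin n → E n × E n → ℝ} (hH : ∀ m, DifferentiableAt ℝ (H m) p)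
    (r : Fin n) :
    dx r (fun q => ∑ m, H m q * q.2 m) p = ∑ m, dx r (H m) p * p.2 m := by
  have hs : ∀ m : Fin n, DifferentiableAt ℝ (fun q : E n × E n => q.2 m) p := fun m => by fun_prop
  rw [dx_sum fun m _ => (hH m).fun_mul (hs m)]
  simp only [dx_mul (hH _) (hs _), dx_snd_apply]
  simp

end Partial

/-! ### Finsler functions in coordinates -/

/-- The part of the coordinate domain of `TM` over `U` that lies off the zero section. -/
def slit (U : Set (E n)) : Set (E n × E n) := U ×ˢ {0}ᶜ

/-- `L` is a Finsler function over the open subset `U` of `ℝⁿ`. -/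
structure IsLocalFinsler (U : Set (E n)) (L : E n × E n → ℝ) : Prop where
  isOpen : IsOpen U
  smooth : ContDiffOn ℝ ∞ L (slit U)
  homogeneous : ∀ x ∈ U, ∀ y : E n, y ≠ 0 → ∀ c : ℝ, 0 < c → L (x, c • y) = c * L (x, y)
  posDef : ∀ p ∈ slit U, (g L p).PosDef

/-- The spray coefficients `g^{ks} (∂g_{si}/∂x^j + ∂g_{sj}/∂x^i - ∂g_{ij}/∂x^s) y^i y^j`. -/
def spray (L : E n × E n → ℝ) (k : Fin n) (q : E n × E n) : ℝ :=
  ∑ s, ∑ i, ∑ j, gInv L q k s * firstKind L q s i j * q.2 j * q.2 i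

namespace IsLocalFinsler

variable {U : Set (E n)} {L : E n × E n → ℝ} {p : E n × E n}

theorem isOpen_slit (hL : IsLocalFinsler U L) : IsOpen (slit U) :=
  hL.isOpen.prod isOpen_compl_singleton

/-! #### Smoothness -/

theorem smooth_sq (hL : IsLocalFinsler U L) : ContDiffOn ℝ ∞ (fun q => L q ^ 2) (slit U) :=
  hL.smooth.pow 2

theorem smooth_dy_sq (hL : IsLocalFinsler U L) (i : Fin n) :
    ContDiffOn ℝ ∞ (dy i fun q => L q ^ 2) (slit U) := contDiffOn_dy hL.isOpen_slit hL.smooth_sq i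

theorem smooth_g (hL : IsLocalFinsler U L) (i j : Fin n) :
    ContDiffOn ℝ ∞ (fun q => g L q i j) (slit U) :=
  contDiffOn_const.mul (contDiffOn_dy hL.isOpen_slit (hL.smooth_dy_sq j) i)

theorem det_g_ne_zero (hL : IsLocalFinsler U L) (hp : p ∈ slit U) : (g L p).det ≠ 0 :=
  (hL.posDef p hp).det_pos.ne'

theorem smooth_gInv (hL : IsLocalFinsler U L) (i j : Fin n) :
    ContDiffOn ℝ ∞ (fun q => gInv L q i j) (slit U) :=
  contDiffOn_matrix_inv_apply hL.smooth_g (fun _ hq => hL.det_g_ne_zero hq) i j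

theorem smooth_firstKind (hL : IsLocalFinsler U L) (s i j : Fin n) :
    ContDiffOn ℝ ∞ (fun q => firstKind L q s i j) (slit U) :=
  ((contDiffOn_dx hL.isOpen_slit (hL.smooth_g s i) j).add
    (contDiffOn_dx hL.isOpen_slit (hL.smooth_g s j) i)).sub
    (contDiffOn_dx hL.isOpen_slit (hL.smooth_g i j) s)

theorem smooth_spray (hL : IsLocalFinsler U L) (k : Fin n) :
    ContDiffOn ℝ ∞ (spray L k) (slit U) :=
  ContDiffOn.sum fun s _ => ContDiffOn.sum fun i _ => ContDiffOn.sum fun j _ =>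
    (((hL.smooth_gInv k s).mul (hL.smooth_firstKind s i j)).mul (contDiffOn_snd_apply j)).mul
      (contDiffOn_snd_apply i)

theorem smooth_nonlin (hL : IsLocalFinsler U L) (k m : Fin n) :
    ContDiffOn ℝ ∞ (fun q => nonlin L q k m) (slit U) :=
  contDiffOn_const.mul (contDiffOn_dy hL.isOpen_slit (hL.smooth_spray k) m)

theorem smooth_hilbert (hL : IsLocalFinsler U L) (i : Fin n) :
    ContDiffOn ℝ ∞ (fun q => hilbert L q i) (slit U) := contDiffOn_dy hL.isOpen_slit hL.smooth i

theorem smooth_cartan (hL : IsLocalFinsler U L) (i j k : Fin n) :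
    ContDiffOn ℝ ∞ (fun q => cartan L q i j k) (slit U) :=
  (hL.smooth.div_const 2).mul (contDiffOn_dy hL.isOpen_slit (hL.smooth_g i j) k)

theorem smooth_cartanUpUp (hL : IsLocalFinsler U L) (k r i : Fin n) :
    ContDiffOn ℝ ∞ (fun q => cartanUpUp L q k r i) (slit U) :=
  ContDiffOn.sum fun a _ => ContDiffOn.sum fun b _ =>
    ((hL.smooth_cartan i a b).mul (hL.smooth_gInv a k)).mul (hL.smooth_gInv b r)

theorem diff (hL : IsLocalFinsler U L) (hp : p ∈ slit U) {h : E n × E n → ℝ}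
    (hh : ContDiffOn ℝ ∞ h (slit U)) : DifferentiableAt ℝ h p :=
  differentiableAt_of_contDiffOn hL.isOpen_slit hh hp

/-! #### The fundamental tensor and homogeneity -/

theorem g_symm (hL : IsLocalFinsler U L) (hp : p ∈ slit U) (i j : Fin n) :
    g L p i j = g L p j i := by
  simp only [g, Matrix.of_apply]
  rw [dy_dy_comm hL.isOpen_slit hL.smooth_sq hp]

theorem sum_gInv_mul_g (hL : IsLocalFinsler U L) (hp : p ∈ slit U) (i j : Fin n) :
    ∑ s, gInv L p i s * g L p s j = if i = j then 1 else 0 := by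
  have := Matrix.nonsing_inv_mul (g L p) (hL.det_g_ne_zero hp).isUnit
  simpa [Matrix.mul_apply, Matrix.one_apply, gInv] using congrFun (congrFun this i) j

theorem sum_g_mul_gInv (hL : IsLocalFinsler U L) (hp : p ∈ slit U) (i j : Fin n) :
    ∑ s, g L p i s * gInv L p s j = if i = j then 1 else 0 := by
  have := Matrix.mul_nonsing_inv (g L p) (hL.det_g_ne_zero hp).isUnit
  simpa [Matrix.mul_apply, Matrix.one_apply, gInv] using congrFun (congrFun this i) j

/-- Raising an index that was lowered. -/
theorem sum_gInv_mul_sum_g (hL : IsLocalFinsler U L) (hp : p ∈ slit U) (v : Fin n → ℝ)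
    (k : Fin n) : ∑ s, gInv L p k s * ∑ m, g L p s m * v m = v k := by
  simp only [Finset.mul_sum, ← mul_assoc]
  rw [Finset.sum_comm]
  simp only [← Finset.sum_mul, hL.sum_gInv_mul_g hp]
  simp

/-- Lowering an index that was raised. -/
theorem sum_g_mul_sum_gInv (hL : IsLocalFinsler U L) (hp : p ∈ slit U) (v : Fin n → ℝ)
    (k : Fin n) : ∑ s, g L p k s * ∑ m, gInv L p s m * v m = v k := by
  simp only [Finset.mul_sum, ← mul_assoc]
  rw [Finset.sum_comm]
  simp only [← Finset.sum_mul, hL.sum_g_mul_gInv hp]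
  simp

/-- Euler's relation for a Finsler function. -/
theorem euler (hL : IsLocalFinsler U L) (hp : p ∈ slit U) :
    ∑ m, dy m L p * p.2 m = L p := by
  obtain ⟨x, y⟩ := p
  have hd := (hL.diff hp hL.smooth).hasFDerivAt
  -- The function `c ↦ L (x, c • y)` is differentiated at `c = 1` by the chain rule and by
  -- homogeneity; the latter needs only `c > 0`, which holds near `1`.
  have hc : HasDerivAt (fun c : ℝ => (x, c • y)) ((0 : E n), y) 1 := by
    have h2 := (hasDerivAt_id (1 : ℝ)).smul_const y
    rw [one_smul] at h2
    exact (hasDerivAt_const (1 : ℝ) x).prodMk h2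
  have h1 : HasDerivAt (fun c : ℝ => L (x, c • y)) (fderiv ℝ L (x, y) (0, y)) 1 := by
    have hd' : HasFDerivAt L (fderiv ℝ L (x, y)) (x, (1 : ℝ) • y) := by rwa [one_smul]
    exact hd'.comp_hasDerivAt (1 : ℝ) hc
  have h2 : HasDerivAt (fun c : ℝ => L (x, c • y)) (L (x, y)) 1 := by
    have h3 : HasDerivAt (fun c : ℝ => c * L (x, y)) (1 * L (x, y)) 1 :=
      (hasDerivAt_id (1 : ℝ)).mul_const _
    rw [one_mul] at h3
    refine h3.congr_of_eventuallyEq ?_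
    filter_upwards [lt_mem_nhds (zero_lt_one' ℝ)] with c hc
    exact hL.homogeneous x hp.1 y hp.2 c hc
  rw [← h1.unique h2, clm_apply_vertical]
  exact Finset.sum_congr rfl fun m _ => mul_comm _ _

theorem dy_sq (hL : IsLocalFinsler U L) (hp : p ∈ slit U) (i : Fin n) :
    dy i (fun q => L q ^ 2) p = 2 * L p * hilbert L p i := by
  have hd := hL.diff hp hL.smooth
  simp only [pow_two, dy_mul hd hd, hilbert]
  ring

theorem dx_sq (hL : IsLocalFinsler U L) (hp : p ∈ slit U) (i : Fin n) :
    dx i (fun q => L q ^ 2) p = 2 * L p * dx i L p := by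
  have hd := hL.diff hp hL.smooth
  simp only [pow_two, dx_mul hd hd]
  ring

theorem euler_sq (hL : IsLocalFinsler U L) (hp : p ∈ slit U) :
    ∑ m, dy m (fun q => L q ^ 2) p * p.2 m = 2 * L p ^ 2 := by
  simp only [hL.dy_sq hp, mul_assoc, ← Finset.mul_sum, hilbert, hL.euler hp]
  ring

/-- The `y^i`-derivative of Euler's relation for `F²`: one of the two copies of `∂F²/∂y^i` cancels.
-/
theorem sum_g_mul_snd (hL : IsLocalFinsler U L) (hp : p ∈ slit U) (i : Fin n) :
    ∑ m, g L p i m * p.2 m = (1 / 2 : ℝ) * dy i (fun q => L q ^ 2) p := by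
  have h := dy_congr hL.isOpen_slit (fun q hq => hL.euler_sq hq) hp i
  rw [dy_sum_mul_snd (fun m => hL.diff hp (hL.smooth_dy_sq m)),
    dy_const_mul (hL.diff hp hL.smooth_sq)] at h
  simp only [g, Matrix.of_apply, mul_assoc, ← Finset.mul_sum]
  linarith

theorem sum_dx_g_mul_snd (hL : IsLocalFinsler U L) (hp : p ∈ slit U) (i k : Fin n) :
    ∑ m, dx k (fun q => g L q i m) p * p.2 m
      = (1 / 2 : ℝ) * dx k (dy i fun q => L q ^ 2) p := by
  rw [← dx_sum_mul_snd (fun m => hL.diff hp (hL.smooth_g i m)),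
    ← dx_const_mul (hL.diff hp (hL.smooth_dy_sq i))]
  exact dx_congr hL.isOpen_slit (fun q hq => hL.sum_g_mul_snd hq i) hp k

theorem sum_dy_g_mul_snd (hL : IsLocalFinsler U L) (hp : p ∈ slit U) (i k : Fin n) :
    ∑ m, dy k (fun q => g L q i m) p * p.2 m = 0 := by
  have h := dy_congr hL.isOpen_slit (fun q hq => hL.sum_g_mul_snd hq i) hp k
  rw [dy_sum_mul_snd (fun m => hL.diff hp (hL.smooth_g i m)),
    dy_const_mul (hL.diff hp (hL.smooth_dy_sq i)), hL.g_symm hp] at h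
  simpa [g] using h

theorem sum_dx_dy_sq_mul_snd (hL : IsLocalFinsler U L) (hp : p ∈ slit U) (k : Fin n) :
    ∑ m, dx k (dy m fun q => L q ^ 2) p * p.2 m = 2 * dx k (fun q => L q ^ 2) p := by
  rw [← dx_sum_mul_snd (fun m => hL.diff hp (hL.smooth_dy_sq m)),
    ← dx_const_mul (hL.diff hp hL.smooth_sq)]
  exact dx_congr hL.isOpen_slit (fun q hq => hL.euler_sq hq) hp k

/-- By Euler's relations `g(y, y) = F²`, which is positive because `g` is positive definite. -/
theorem ne_zero (hL : IsLocalFinsler U L) (hp : p ∈ slit U) : L p ≠ 0 := by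
  have hy : (p.2 : Fin n → ℝ) ≠ 0 := fun h => hp.2 (by ext i; exact congrFun h i)
  have h := (hL.posDef p hp).dotProduct_mulVec_pos hy
  have h2 : dotProduct (star (p.2 : Fin n → ℝ)) ((g L p).mulVec p.2) = L p ^ 2 := by
    simp only [dotProduct, Matrix.mulVec, hL.sum_g_mul_snd hp, Pi.star_apply, star_trivial]
    have := hL.euler_sq hp
    calc _ = (1 / 2 : ℝ) * ∑ m, dy m (fun q => L q ^ 2) p * p.2 m := by
          rw [Finset.mul_sum]; exact Finset.sum_congr rfl fun m _ => by ring
      _ = _ := by rw [this]; ring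
  rw [h2] at h
  exact fun h0 => by simp [h0] at h

theorem mul_hilbert (hL : IsLocalFinsler U L) (hp : p ∈ slit U) (i : Fin n) :
    L p * hilbert L p i = ∑ m, g L p i m * p.2 m := by
  rw [hL.sum_g_mul_snd hp, hL.dy_sq hp]; ring

theorem hilbertUp_eq (hL : IsLocalFinsler U L) (hp : p ∈ slit U) (k : Fin n) :
    hilbertUp L p k = p.2 k / L p := by
  rw [eq_div_iff (hL.ne_zero hp), ← hL.sum_gInv_mul_sum_g hp (fun m => p.2 m) k]
  simp only [← hL.mul_hilbert hp, hilbertUp, Finset.sum_mul]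
  exact Finset.sum_congr rfl fun m _ => by ring

theorem sum_hilbertUp_mul_hilbert (hL : IsLocalFinsler U L) (hp : p ∈ slit U) :
    ∑ r, hilbertUp L p r * hilbert L p r = 1 := by
  have h := hL.euler hp
  have h0 := hL.ne_zero hp
  calc _ = (∑ m, dy m L p * p.2 m) / L p := by
        rw [Finset.sum_div]
        exact Finset.sum_congr rfl fun m _ => by rw [hL.hilbertUp_eq hp, hilbert]; ring
    _ = 1 := by rw [h, div_self h0]

/-- Obtained by differentiating `F ω_r = ½ ∂F²/∂y^r` in `y^j`. -/
theorem mul_dy_hilbert (hL : IsLocalFinsler U L) (hp : p ∈ slit U) (j r : Fin n) :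
    L p * dy j (fun q => hilbert L q r) p = g L p r j - hilbert L p j * hilbert L p r := by
  have h := dy_congr hL.isOpen_slit (h := fun q => L q * hilbert L q r)
    (k := fun q => (1 / 2 : ℝ) * dy r (fun q => L q ^ 2) q)
    (fun q hq => by simp only [hL.dy_sq hq]; ring) hp j
  rw [dy_mul (hL.diff hp hL.smooth) (hL.diff hp (hL.smooth_hilbert r)),
    dy_const_mul (hL.diff hp (hL.smooth_dy_sq r))] at h
  rw [hL.g_symm hp]
  simp only [g, Matrix.of_apply, ← h, hilbert]
  ring

/-! #### The Cartan tensor -/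

theorem dy_g_symm (hL : IsLocalFinsler U L) (hp : p ∈ slit U) (i j k : Fin n) :
    dy k (fun q => g L q i j) p = dy k (fun q => g L q j i) p :=
  dy_congr hL.isOpen_slit (fun _ hq => hL.g_symm hq i j) hp k

/-- Third `y`-derivatives of `F²` commute. With the symmetry of `g` this makes the Cartan tensor
totally symmetric. -/
theorem dy_g_swap (hL : IsLocalFinsler U L) (hp : p ∈ slit U) (i j k : Fin n) :
    dy k (fun q => g L q i j) p = dy i (fun q => g L q k j) p := by
  have hd : ∀ i, DifferentiableAt ℝ (dy i (dy j fun q => L q ^ 2)) p := fun i =>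
    hL.diff hp (contDiffOn_dy hL.isOpen_slit (hL.smooth_dy_sq j) i)
  simp only [g, Matrix.of_apply]
  rw [dy_const_mul (hd i), dy_const_mul (hd k), dy_dy_comm hL.isOpen_slit (hL.smooth_dy_sq j) hp]

theorem cartan_symm (hL : IsLocalFinsler U L) (hp : p ∈ slit U) (i j k : Fin n) :
    cartan L p i j k = cartan L p j i k := by rw [cartan, cartan, hL.dy_g_symm hp]

theorem cartan_swap (hL : IsLocalFinsler U L) (hp : p ∈ slit U) (i j k : Fin n) :
    cartan L p i j k = cartan L p k j i := by rw [cartan, cartan, hL.dy_g_swap hp]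

theorem cartan_swap_right (hL : IsLocalFinsler U L) (hp : p ∈ slit U) (i j k : Fin n) :
    cartan L p i j k = cartan L p i k j := by
  rw [hL.cartan_symm hp, hL.cartan_swap hp, hL.cartan_symm hp]

/-- Here `ω^m = y^m / F`, so total symmetry reduces the sum to the Euler-type relation `y^m
∂g_{im}/∂y^j = 0`. -/
theorem sum_cartan_mul_hilbertUp (hL : IsLocalFinsler U L) (hp : p ∈ slit U) (i j : Fin n) :
    ∑ m, cartan L p i j m * hilbertUp L p m = 0 := by
  have h := hL.sum_dy_g_mul_snd hp i j
  calc _ = (1 / 2 : ℝ) * ∑ m, dy j (fun q => g L q i m) p * p.2 m := by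
        rw [Finset.mul_sum]
        refine Finset.sum_congr rfl fun m _ => ?_
        have h0 := hL.ne_zero hp
        rw [hL.cartan_swap_right hp, hL.hilbertUp_eq hp, cartan]
        field_simp
    _ = 0 := by rw [h, mul_zero]

theorem sum_cartanUp_mul_hilbert (hL : IsLocalFinsler U L) (hp : p ∈ slit U) (i j : Fin n) :
    ∑ r, cartanUp L p r i j * hilbert L p r = 0 := by
  rw [← hL.sum_cartan_mul_hilbertUp hp i j]
  simp only [cartanUp, hilbertUp, Finset.sum_mul, Finset.mul_sum]
  rw [Finset.sum_comm]
  exact Finset.sum_congr rfl fun a _ => Finset.sum_congr rfl fun b _ => by ring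

theorem cartanUpUp_symm (hL : IsLocalFinsler U L) (hp : p ∈ slit U) (k r i : Fin n) :
    cartanUpUp L p k r i = cartanUpUp L p r k i := by
  simp only [cartanUpUp]
  rw [Finset.sum_comm]
  exact Finset.sum_congr rfl fun a _ => Finset.sum_congr rfl fun b _ => by
    rw [hL.cartan_swap_right hp]; ring

theorem sum_cartanUpUp_mul_hilbert (hL : IsLocalFinsler U L) (hp : p ∈ slit U) (k i : Fin n) :
    ∑ r, cartanUpUp L p k r i * hilbert L p r = 0 := by
  calc _ = ∑ a, gInv L p a k * ∑ b, cartan L p i a b * hilbertUp L p b := by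
        simp only [cartanUpUp, hilbertUp, Finset.sum_mul, Finset.mul_sum]
        rw [Finset.sum_comm]
        refine Finset.sum_congr rfl fun a _ => ?_
        rw [Finset.sum_comm]
        exact Finset.sum_congr rfl fun b _ => Finset.sum_congr rfl fun r _ => by ring
    _ = 0 := by simp [hL.sum_cartan_mul_hilbertUp hp]

theorem sum_cartanUpUp_mul_g (hL : IsLocalFinsler U L) (hp : p ∈ slit U) (k i j : Fin n) :
    ∑ r, cartanUpUp L p k r i * g L p r j = cartanUp L p k i j := by
  calc _ = ∑ a, ∑ b, cartan L p i a b * gInv L p a k * ∑ r, gInv L p b r * g L p r j := by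
        simp only [cartanUpUp, Finset.sum_mul, Finset.mul_sum]
        rw [Finset.sum_comm]
        refine Finset.sum_congr rfl fun a _ => ?_
        rw [Finset.sum_comm]
        exact Finset.sum_congr rfl fun b _ => Finset.sum_congr rfl fun r _ => by ring
    _ = _ := by
        simp only [hL.sum_gInv_mul_g hp, cartanUp]
        refine Finset.sum_congr rfl fun a _ => ?_
        rw [hL.cartan_swap_right hp]
        simp

/-! #### The nonlinear connection -/

/-- Euler's relations turn each of the first two terms of `firstKind` into half of the sum on the
right and the third into `∂F²/∂x^s`. The result is the Euler–Lagrange expression of `F²`. -/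
theorem sum_firstKind (hL : IsLocalFinsler U L) (hp : p ∈ slit U) (s : Fin n) :
    ∑ i, ∑ j, firstKind L p s i j * p.2 j * p.2 i
      = ∑ j, dx j (dy s fun q => L q ^ 2) p * p.2 j - dx s (fun q => L q ^ 2) p := by
  have h1 : ∑ i, ∑ j, dx j (fun q => g L q s i) p * p.2 j * p.2 i
      = (1 / 2 : ℝ) * ∑ j, dx j (dy s fun q => L q ^ 2) p * p.2 j := by
    rw [Finset.sum_comm, Finset.mul_sum]
    refine Finset.sum_congr rfl fun j _ => ?_
    rw [← mul_assoc, ← hL.sum_dx_g_mul_snd hp, Finset.sum_mul]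
    exact Finset.sum_congr rfl fun i _ => by ring
  have h2 : ∑ i, ∑ j, dx i (fun q => g L q s j) p * p.2 j * p.2 i
      = (1 / 2 : ℝ) * ∑ j, dx j (dy s fun q => L q ^ 2) p * p.2 j := by
    rw [← h1, Finset.sum_comm]
    exact Finset.sum_congr rfl fun i _ => Finset.sum_congr rfl fun j _ => by ring
  have h3 : ∑ i, ∑ j, dx s (fun q => g L q i j) p * p.2 j * p.2 i
      = dx s (fun q => L q ^ 2) p := by
    simp only [← Finset.sum_mul, hL.sum_dx_g_mul_snd hp]
    simp only [mul_assoc, ← Finset.mul_sum, hL.sum_dx_dy_sq_mul_snd hp]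
    ring
  simp only [firstKind, add_mul, sub_mul, Finset.sum_add_distrib, Finset.sum_sub_distrib, h1, h2,
    h3]
  ring

theorem spray_eq (k : Fin n) :
    spray L k p = ∑ s, gInv L p k s * ∑ i, ∑ j, firstKind L p s i j * p.2 j * p.2 i := by
  simp only [spray, Finset.mul_sum, mul_assoc]

theorem sum_g_mul_spray (hL : IsLocalFinsler U L) (hp : p ∈ slit U) (r : Fin n) :
    ∑ k, g L p r k * spray L k p
      = ∑ j, dx j (dy r fun q => L q ^ 2) p * p.2 j - dx r (fun q => L q ^ 2) p := by
  simp only [spray_eq]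
  rw [hL.sum_g_mul_sum_gInv hp, hL.sum_firstKind hp]

/-- Conservation of energy: the geodesic vector field `y^j ∂/∂x^j - ½ G^k ∂/∂y^k`, with `G` the
`spray`, annihilates `F²`. It follows by contracting the Euler–Lagrange expression with `y`. -/
theorem sum_spray_mul_dy_sq (hL : IsLocalFinsler U L) (hp : p ∈ slit U) :
    ∑ k, spray L k p * dy k (fun q => L q ^ 2) p
      = 2 * ∑ j, dx j (fun q => L q ^ 2) p * p.2 j := by
  have h1 : ∑ k, spray L k p * dy k (fun q => L q ^ 2) p
      = 2 * ∑ m, (∑ k, g L p m k * spray L k p) * p.2 m := by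
    have : ∀ k, dy k (fun q => L q ^ 2) p = 2 * ∑ m, g L p k m * p.2 m := fun k => by
      rw [hL.sum_g_mul_snd hp]; ring
    simp only [this, Finset.sum_mul, Finset.mul_sum]
    rw [Finset.sum_comm]
    exact Finset.sum_congr rfl fun i _ => Finset.sum_congr rfl fun j _ => by
      rw [hL.g_symm hp]; ring
  have h2 : ∑ m, (∑ j, dx j (dy m fun q => L q ^ 2) p * p.2 j) * p.2 m
      = ∑ j, 2 * dx j (fun q => L q ^ 2) p * p.2 j := by
    simp only [← hL.sum_dx_dy_sq_mul_snd hp, Finset.sum_mul]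
    rw [Finset.sum_comm]
    exact Finset.sum_congr rfl fun i _ => Finset.sum_congr rfl fun j _ => by ring
  rw [h1]
  simp only [hL.sum_g_mul_spray hp, sub_mul, Finset.sum_sub_distrib, h2, mul_assoc,
    ← Finset.mul_sum]
  ring

/-- The horizontal derivative of `L²` vanishes. -/
theorem dx_sq_eq_sum_nonlin (hL : IsLocalFinsler U L) (hp : p ∈ slit U) (r : Fin n) :
    dx r (fun q => L q ^ 2) p = ∑ k, nonlin L p k r * dy k (fun q => L q ^ 2) p := by
  have hsp := fun k => hL.diff hp (hL.smooth_spray k)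
  have hdy := fun k => hL.diff hp (hL.smooth_dy_sq k)
  have hdx := fun k => contDiffOn_dx hL.isOpen_slit hL.smooth_sq k
  -- Conservation of energy is differentiated in `y^r`. The Hessian term is twice the lowered spray,
  -- whose mixed derivatives cancel those on the right; what remains is `∂G^k/∂y^r · ∂F²/∂y^k = 4
  -- ∂F²/∂x^r`, and `N = ¼ ∂G/∂y`.
  have h := dy_congr hL.isOpen_slit (fun q hq => hL.sum_spray_mul_dy_sq hq) hp r
  rw [dy_sum (fun k _ => (hsp k).fun_mul (hdy k)), dy_const_mul (hL.diff hp
    (ContDiffOn.sum fun j _ => (hdx j).mul (contDiffOn_snd_apply j))),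
    dy_sum_mul_snd (fun j => hL.diff hp (hdx j))] at h
  simp only [dy_mul (hsp _) (hdy _), Finset.sum_add_distrib,
    dy_dx_comm hL.isOpen_slit hL.smooth_sq hp] at h
  have h2 : ∑ k, spray L k p * dy r (dy k fun q => L q ^ 2) p
      = 2 * ∑ k, g L p r k * spray L k p := by
    rw [Finset.mul_sum]
    exact Finset.sum_congr rfl fun k _ => by simp only [g, Matrix.of_apply]; ring
  rw [h2, hL.sum_g_mul_spray hp] at h
  have h3 : ∑ k, nonlin L p k r * dy k (fun q => L q ^ 2) p
      = (1 / 4 : ℝ) * ∑ k, dy r (spray L k) p * dy k (fun q => L q ^ 2) p := by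
    rw [Finset.mul_sum]
    exact Finset.sum_congr rfl fun k _ => by rw [← mul_assoc]; rfl
  rw [h3]
  linarith

/-- The horizontal derivative of `L` vanishes. -/
theorem dx_eq_sum_nonlin (hL : IsLocalFinsler U L) (hp : p ∈ slit U) (r : Fin n) :
    dx r L p = ∑ k, nonlin L p k r * dy k L p := by
  have h := hL.dx_sq_eq_sum_nonlin hp r
  have h0 : 2 * L p ≠ 0 := mul_ne_zero two_ne_zero (hL.ne_zero hp)
  simp only [hL.dx_sq hp, hL.dy_sq hp] at h
  refine mul_left_cancel₀ h0 (h.trans ?_)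
  rw [Finset.mul_sum]
  exact Finset.sum_congr rfl fun k _ => by rw [hilbert]; ring

/-! #### The Berwald connection and the Landsberg tensor -/

/-- Both sides are second `y`-derivatives of the spray, so the Berwald connection is torsion-free.
-/
theorem berwald_symm (hL : IsLocalFinsler U L) (hp : p ∈ slit U) (k i j : Fin n) :
    berwald L p k i j = berwald L p k j i := by
  have hd := fun i => hL.diff hp (contDiffOn_dy hL.isOpen_slit (hL.smooth_spray k) i)
  have h : ∀ i j, berwald L p k i j = (1 / 4 : ℝ) * dy j (dy i (spray L k)) p := fun i j =>
    dy_const_mul (hd i) _ _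
  rw [h, h, dy_dy_comm hL.isOpen_slit (hL.smooth_spray k) hp]

/-- The horizontal Berwald derivative of the fundamental tensor is `-2` times the Landsberg
tensor. -/
theorem dx_g_eq (hL : IsLocalFinsler U L) (hp : p ∈ slit U) (r i j : Fin n) :
    dx r (fun q => g L q i j) p = ∑ m, nonlin L p m r * dy m (fun q => g L q i j) p
      + ∑ m, g L p i m * berwald L p m r j + ∑ m, g L p j m * berwald L p m r i
      - 2 * landsberg L p r i j := by
  have hO := hL.isOpen_slit
  have hN := fun m => hL.smooth_nonlin m r
  have hdN := fun m j => contDiffOn_dy hO (hN m) j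
  have hQ := hL.smooth_dy_sq
  have hdQ := fun m j => contDiffOn_dy hO (hQ m) j
  -- Horizontal constancy of `F²` is differentiated in `y^j`, then in `y^i`.
  have h1 : ∀ q ∈ slit U, dx r (dy j fun q => L q ^ 2) q
      = ∑ m, (dy j (fun q => nonlin L q m r) q * dy m (fun q => L q ^ 2) q
        + nonlin L q m r * dy j (dy m fun q => L q ^ 2) q) := fun q hq => by
    rw [← dy_dx_comm hO hL.smooth_sq hq,
      dy_congr hO (fun q hq => hL.dx_sq_eq_sum_nonlin hq r) hq,
      dy_sum (fun m _ => (hL.diff hq (hN m)).fun_mul (hL.diff hq (hQ m)))]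
    simp only [dy_mul (hL.diff hq (hN _)) (hL.diff hq (hQ _))]
  have h2 := dy_congr hO h1 hp i
  rw [dy_sum (fun m _ => ((hL.diff hp (hdN m j)).fun_mul (hL.diff hp (hQ m))).fun_add
    ((hL.diff hp (hN m)).fun_mul (hL.diff hp (hdQ m j))))] at h2
  have hg : ∀ i j, DifferentiableAt ℝ (fun q => g L q i j) p := fun i j =>
    hL.diff hp (hL.smooth_g i j)
  have h3 : ∀ i j k, dy k (dy i (dy j fun q => L q ^ 2)) p
      = 2 * dy k (fun q => g L q i j) p := fun i j k => by
    rw [← dy_const_mul (hg i j)]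
    exact dy_congr hO (fun q _ => by simp only [g, Matrix.of_apply]; ring) hp k
  have h4 : dy i (dx r (dy j fun q => L q ^ 2)) p = 2 * dx r (fun q => g L q i j) p := by
    rw [dy_dx_comm hO (hQ j) hp, ← dx_const_mul (hg i j)]
    exact dx_congr hO (fun q _ => by simp only [g, Matrix.of_apply]; ring) hp r
  -- The second derivatives of `N` enter paired with `∂F²/∂y^m = 2 y_m`, which is exactly the
  -- Landsberg tensor.
  have h5 : landsberg L p r i j = -(1 / 4 : ℝ) *
      ∑ m, dy i (dy j fun q => nonlin L q m r) p * dy m (fun q => L q ^ 2) p := by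
    simp only [landsberg, hL.sum_g_mul_snd hp, Finset.mul_sum]
    exact Finset.sum_congr rfl fun m _ => by ring
  have h6 : ∀ i m, dy i (dy m fun q => L q ^ 2) p = 2 * g L p i m := fun i m => by
    simp only [g, Matrix.of_apply]; ring
  change dy i (dx r (dy j fun q => L q ^ 2)) p = _ at h2
  rw [h4] at h2
  have h7 : ∀ m, dy i (fun q => dy j (fun q => nonlin L q m r) q * dy m (fun q => L q ^ 2) q
        + nonlin L q m r * dy j (dy m fun q => L q ^ 2) q) p
      = dy i (dy j fun q => nonlin L q m r) p * dy m (fun q => L q ^ 2) p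
        + 2 * (g L p i m * berwald L p m r j) + 2 * (g L p j m * berwald L p m r i)
        + 2 * (nonlin L p m r * dy m (fun q => g L q i j) p) := fun m => by
    rw [dy_add ((hL.diff hp (hdN m j)).fun_mul (hL.diff hp (hQ m)))
      ((hL.diff hp (hN m)).fun_mul (hL.diff hp (hdQ m j))),
      dy_mul (hL.diff hp (hdN m j)) (hL.diff hp (hQ m)),
      dy_mul (hL.diff hp (hN m)) (hL.diff hp (hdQ m j)), h3, h6, h6, hL.dy_g_symm hp,
      hL.dy_g_swap hp]
    simp only [berwald]
    ring
  simp only [h7, Finset.sum_add_distrib, ← Finset.mul_sum] at h2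
  linarith

/-- On a Landsberg space, the Chern and the Berwald connections coincide. -/
theorem chern_eq_berwald (hL : IsLocalFinsler U L) (hp : p ∈ slit U)
    (hl : ∀ i j k, landsberg L p i j k = 0) (k i j : Fin n) :
    chern L p k i j = berwald L p k i j := by
  -- By total symmetry the Cartan terms in the Chern symbols are the vertical parts of horizontal
  -- derivatives of `g`.
  have hc : ∀ a s i, ∑ m, nonlin L p m a / L p * cartan L p m s i
      = (1 / 2 : ℝ) * ∑ m, nonlin L p m a * dy m (fun q => g L q s i) p := fun a s i => by
    rw [Finset.mul_sum]
    refine Finset.sum_congr rfl fun m _ => ?_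
    have h0 := hL.ne_zero hp
    rw [hL.cartan_swap hp, hL.cartan_symm hp, cartan]
    field_simp
  have hb : ∀ s a c, ∑ m, g L p s m * berwald L p m a c = ∑ m, g L p s m * berwald L p m c a :=
    fun s a c => Finset.sum_congr rfl fun m _ => by rw [hL.berwald_symm hp]
  -- Writing the Berwald symbol as lowered and raised again reduces the claim to an identity for
  -- each lowered index `s`.
  rw [← hL.sum_gInv_mul_sum_g hp (fun m => berwald L p m i j) k, chern, Finset.mul_sum,
    ← Finset.sum_sub_distrib]
  refine Finset.sum_congr rfl fun s _ => ?_
  rw [mul_left_comm, ← mul_sub]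
  congr 1
  -- The Christoffel trick: with `Ȧ = 0` the vertical terms cancel, and in the alternating sum of
  -- three metricity relations the symmetry `hb` leaves only `2 g_{sm} ♭γ^m_{ij}`.
  simp only [Finset.sum_add_distrib, Finset.sum_sub_distrib, hc, firstKind, hL.dx_g_eq hp, hl]
  linarith [hb s i j, hb i s j, hb j s i]

/-! #### The tensors `B` -/

/-- The horizontal part of `d log F` vanishes by horizontal constancy, so `a` drops out and only the
vertical part survives. -/
theorem dLog_eq (hL : IsLocalFinsler U L) (hp : p ∈ slit U) (a b : E n × E n → ℝ) (r : Fin n) :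
    dLog L a b p r = b p / L p * hilbert L p r := by
  have hd := hL.diff hp hL.smooth
  have h := hL.dx_eq_sum_nonlin hp r
  rw [dLog, fderiv.log hd (hL.ne_zero hp), uMap]
  simp only [smul_apply, smul_eq_mul]
  have h1 : ∑ m, nonlin L p m r * ((L p)⁻¹ * fderiv ℝ L p (0, e m))
      = (L p)⁻¹ * fderiv ℝ L p (e r, 0) := by
    change _ = (L p)⁻¹ * dx r L p
    rw [h, Finset.mul_sum]
    exact Finset.sum_congr rfl fun m _ => by rw [dy]; ring
  rw [h1, hilbert, dy]
  ring

/-- After `d_r log F` becomes a multiple of `ω_r`, every term carrying the index `r` on a Cartan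
tensor dies, the quadratic ones included. Only `-A^k_{ij} ω^r` survives, through `ω^r ω_r = 1`. -/
theorem chernB_eq (hL : IsLocalFinsler U L) (hp : p ∈ slit U) (a b : E n × E n → ℝ)
    (k i j : Fin n) : chernB L a b p k i j = -(b p / L p) * cartanUp L p k i j := by
  have hU : ∀ k i, ∑ r, cartanUpUp L p k r i * hilbert L p r = 0 :=
    hL.sum_cartanUpUp_mul_hilbert hp
  have hU' : ∀ k i, ∑ r, cartanUpUp L p r k i * hilbert L p r = 0 := fun k i => by
    simpa only [hL.cartanUpUp_symm hp] using hU k i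
  have hq : ∀ i j, ∑ r, ∑ s, cartanUp L p k i s * cartanUpUp L p s r j * hilbert L p r = 0 :=
    fun i j => by
      rw [Finset.sum_comm]
      simp only [mul_assoc, ← Finset.mul_sum, hU, mul_zero, Finset.sum_const_zero]
  have hq' : ∑ r, ∑ s, cartanUpUp L p r k s * cartanUp L p s i j * hilbert L p r = 0 := by
    rw [Finset.sum_comm]
    simp only [mul_right_comm _ (cartanUp L p _ i j), ← Finset.sum_mul, hU', zero_mul,
      Finset.sum_const_zero]
  simp only [chernB, hL.dLog_eq hp]
  calc _ = b p / L p * (hilbert L p j * ∑ r, cartanUpUp L p k r i * hilbert L p r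
        + hilbert L p i * ∑ r, cartanUpUp L p k r j * hilbert L p r
        - cartanUp L p k i j * ∑ r, hilbertUp L p r * hilbert L p r
        - hilbertUp L p k * ∑ r, cartanUp L p r i j * hilbert L p r
        - ∑ r, ∑ s, cartanUp L p k i s * cartanUpUp L p s r j * hilbert L p r
        - ∑ r, ∑ s, cartanUp L p k j s * cartanUpUp L p s r i * hilbert L p r
        + ∑ r, ∑ s, cartanUpUp L p r k s * cartanUp L p s i j * hilbert L p r) := by
        simp only [Finset.mul_sum, ← Finset.sum_add_distrib, ← Finset.sum_sub_distrib,
          ← Finset.sum_mul]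
        exact Finset.sum_congr rfl fun r _ => by ring
    _ = _ := by
        rw [hU, hU, hL.sum_hilbertUp_mul_hilbert hp, hL.sum_cartanUp_mul_hilbert hp, hq, hq, hq']
        ring

/-- Only the derivative term survives contraction with `ω_r`. Differentiating `A^{kr}_i ω_r = 0` in
`y^j` moves the derivative onto `ω_r`, and `F ∂ω_r/∂y^j = g_{rj} - ω_j ω_r` then lowers `r`, with a
minus sign. -/
theorem berwaldB_eq (hL : IsLocalFinsler U L) (hp : p ∈ slit U) (a b : E n × E n → ℝ)
    (k i j : Fin n) : berwaldB L a b p k i j = -(b p / L p) * cartanUp L p k i j := by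
  have hU : ∀ k i, ∑ r, cartanUpUp L p k r i * hilbert L p r = 0 :=
    hL.sum_cartanUpUp_mul_hilbert hp
  have hU' : ∀ k i, ∑ r, cartanUpUp L p r k i * hilbert L p r = 0 := fun k i => by
    simpa only [hL.cartanUpUp_symm hp] using hU k i
  have hc := fun r => hL.diff hp (hL.smooth_cartanUpUp k r i)
  have hh := fun r => hL.diff hp (hL.smooth_hilbert r)
  have h := dy_congr hL.isOpen_slit (fun q hq => hL.sum_cartanUpUp_mul_hilbert hq k i) hp j
  have h0 : dy j (fun _ : E n × E n => (0 : ℝ)) p = 0 := by simp [dy]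
  rw [h0, dy_sum fun r _ => (hc r).fun_mul (hh r)] at h
  simp only [dy_mul (hc _) (hh _), Finset.sum_add_distrib] at h
  have h1 : L p * ∑ r, cartanUpUp L p k r i * dy j (fun q => hilbert L q r) p
      = cartanUp L p k i j := by
    calc _ = ∑ r, cartanUpUp L p k r i * g L p r j
          - hilbert L p j * ∑ r, cartanUpUp L p k r i * hilbert L p r := by
          rw [Finset.mul_sum, Finset.mul_sum, ← Finset.sum_sub_distrib]
          exact Finset.sum_congr rfl fun r _ => by
            rw [mul_left_comm, hL.mul_dy_hilbert hp]; ring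
      _ = _ := by rw [hU, hL.sum_cartanUpUp_mul_g hp]; ring
  simp only [berwaldB, hL.dLog_eq hp]
  calc _ = b p / L p * (L p * ∑ r, dy j (fun q => cartanUpUp L q k r i) p * hilbert L p r
        + hilbert L p j * ∑ r, cartanUpUp L p k r i * hilbert L p r
        + 2 * hilbert L p i * ∑ r, cartanUpUp L p r k j * hilbert L p r) := by
        simp only [Finset.mul_sum, ← Finset.sum_add_distrib]
        exact Finset.sum_congr rfl fun r _ => by ring
    _ = _ := by
        rw [hU, hU', ← h1, eq_neg_of_add_eq_zero_left h]
        ring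

end IsLocalFinsler

/-! ### Finsler structures on a manifold -/

section Manifold

variable {M : Type*} [TopologicalSpace M] [ChartedSpace (E n) M]
  {φ : OpenPartialHomeomorph M (E n)}

/-- The derivative of an inverse chart is injective. -/
theorem lift_snd_ne_zero (hφ : φ ∈ IsManifold.maximalAtlas (𝓡 n) ∞ M) {x y : E n}
    (hx : x ∈ φ.target) (hy : y ≠ 0) : (lift φ (x, y)).2 ≠ 0 := by
  have hd : φ.MDifferentiable (𝓡 n) (𝓡 n) :=
    ⟨(contMDiffOn_of_mem_maximalAtlas hφ).mdifferentiableOn (by simp),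
      (contMDiffOn_symm_of_mem_maximalAtlas hφ).mdifferentiableOn (by simp)⟩
  intro h
  exact hy (hd.symm.mfderiv_injective hx (h.trans (map_zero _).symm))

/-- The operator `𝒜(f)` depends on the connection and on the tensor `B` only through their
components at the point and at its image. -/
theorem cocycleOp_congr (F : TangentBundle (𝓡 n) M → ℝ) (δ : ℝ)
    {Γ Γ' B B' : OpenPartialHomeomorph M (E n) → E n × E n → Fin n → Fin n → Fin n → ℝ}
    (f : M ≃ₘ^∞⟮𝓡 n, 𝓡 n⟯ M)
    (P : OpenPartialHomeomorph M (E n) → E n → Fin n → Fin n → ℝ) {p : E n × E n}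
    (hΓ : Γ φ p = Γ' φ p) (hfΓ : pullback f Γ φ p = pullback f Γ' φ p)
    (hB : B φ p = B' φ p) (hfB : pullback f B φ p = pullback f B' φ p) (k : Fin n) :
    cocycleOp F δ Γ B f P φ p k = cocycleOp F δ Γ' B' f P φ p k := by
  have h1 : correction F δ B φ p = correction F δ B' φ p := by
    funext k i j; simp only [correction, hB]
  have h2 : pullback f (correction F δ B) φ p = pullback f (correction F δ B') φ p := by
    funext k i j
    simp only [pullback] at hfB ⊢
    simp only [correction, hfB]
  have h3 : divOp F δ Γ P φ p = divOp F δ Γ' P φ p := by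
    funext k; simp only [divOp, hΓ]
  have h4 : pullbackOp f (divOp F δ Γ) P φ p = pullbackOp f (divOp F δ Γ') P φ p := by
    funext k
    simp only [pullbackOp, pullback] at hfΓ ⊢
    simp only [divOp, hfΓ]
  simp only [cocycleOp, h1, h2, h3, h4, hΓ, hfΓ, hB, hfB]

variable [IsManifold (𝓡 n) ∞ M]

theorem contMDiffOn_lift (hφ : φ ∈ IsManifold.maximalAtlas (𝓡 n) ∞ M) :
    ContMDiffOn 𝓘(ℝ, E n × E n) (𝓡 n).tangent ∞ (lift φ : E n × E n → TangentBundle (𝓡 n) M)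
      (slit φ.target) := by
  have h1 : ContMDiffOn (𝓡 n).tangent (𝓡 n).tangent ∞ (tangentMap (𝓡 n) (𝓡 n) φ.symm)
      (Bundle.TotalSpace.proj ⁻¹' φ.target) := by
    -- On the open target the tangent map within the set is the full tangent map.
    refine ((contMDiffOn_symm_of_mem_maximalAtlas hφ).contMDiffOn_tangentMapWithin
      (by simp) φ.open_target.uniqueMDiffOn).congr fun v hv => ?_
    exact (tangentMapWithin_eq_tangentMap (φ.open_target.uniqueMDiffOn _ hv)
      ((contMDiffAt_symm_of_mem_maximalAtlas hφ hv).mdifferentiableAt (by simp))).symm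
  have h2 : ContMDiff 𝓘(ℝ, E n × E n) (𝓡 n).tangent ∞
      (fun p : E n × E n => (⟨p.1, p.2⟩ : TangentBundle (𝓡 n) (E n))) := by
    have := contMDiff_tangentBundleModelSpaceHomeomorph_symm (I := 𝓡 n) (n := ∞)
    rw [modelWithCornersSelf_prod]
    exact this
  exact h1.comp h2.contMDiffOn fun p hp => hp.1

theorem IsFinsler.isLocalFinsler {F : TangentBundle (𝓡 n) M → ℝ} (hF : IsFinsler F)
    (hφ : φ ∈ IsManifold.maximalAtlas (𝓡 n) ∞ M) :
    IsLocalFinsler φ.target (local_ F φ) where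
  isOpen := φ.open_target
  smooth := contMDiffOn_iff_contDiffOn.1 <|
    hF.smooth.comp (contMDiffOn_lift hφ) fun _ hp => lift_snd_ne_zero hφ hp.1 hp.2
  homogeneous x _ y _ c hc := by
    have h := hF.homogeneous (φ.symm x) (mfderiv (𝓡 n) (𝓡 n) φ.symm x y) c hc
    have hs := map_smul (mfderiv (𝓡 n) (𝓡 n) φ.symm x) c y
    exact (congrArg (fun v => F ⟨φ.symm x, v⟩) hs).trans h
  posDef p hp := hF.posDef φ hφ p.1 hp.1 p.2 hp.2

/-- Pulling back by `f` means evaluating in the chart `φ ∘ f⁻¹`. As this is again a smooth chart,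
identities valid in all charts cover the pulled-back objects as well. -/
theorem symm_trans_mem_maximalAtlas (f : M ≃ₘ^∞⟮𝓡 n, 𝓡 n⟯ M)
    (hφ : φ ∈ IsManifold.maximalAtlas (𝓡 n) ∞ M) :
    f.symm.toHomeomorph.toOpenPartialHomeomorph.trans φ ∈ IsManifold.maximalAtlas (𝓡 n) ∞ M := by
  refine OpenPartialHomeomorph.mem_maximalAtlas_of_contMDiffOn _ ?_ ?_
  · exact (contMDiffOn_of_mem_maximalAtlas hφ).comp f.symm.contMDiff.contMDiffOn
      fun x hx => by simpa using hx
  · exact f.contMDiff.comp_contMDiffOn ((contMDiffOn_symm_of_mem_maximalAtlas hφ).mono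
      fun x hx => by simpa using hx)

theorem IsFinsler.chern_eq_berwald {F : TangentBundle (𝓡 n) M → ℝ} (hF : IsFinsler F)
    (hL : IsLandsberg F) (hφ : φ ∈ IsManifold.maximalAtlas (𝓡 n) ∞ M) {p : E n × E n}
    (hp : p ∈ slit φ.target) : chern (local_ F φ) p = berwald (local_ F φ) p := by
  funext k i j
  exact (hF.isLocalFinsler hφ).chern_eq_berwald hp (hL φ hφ p.1 hp.1 p.2 hp.2) k i j

theorem IsFinsler.chernB_eq_berwaldB {F : TangentBundle (𝓡 n) M → ℝ} (hF : IsFinsler F)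
    (a b : E n × E n → ℝ) (hφ : φ ∈ IsManifold.maximalAtlas (𝓡 n) ∞ M) {p : E n × E n}
    (hp : p ∈ slit φ.target) : chernB (local_ F φ) a b p = berwaldB (local_ F φ) a b p := by
  funext k i j
  rw [(hF.isLocalFinsler hφ).chernB_eq hp, (hF.isLocalFinsler hφ).berwaldB_eq hp]

end Manifold

end Finsler

end

theorem proposition4p6 {n : ℕ} {M : Type*} [TopologicalSpace M]
    [ChartedSpace (EuclideanSpace ℝ (Fin n)) M] [IsManifold (𝓡 n) ∞ M]
    (F : TangentBundle (𝓡 n) M → ℝ) (hF : Finsler.IsFinsler F) (hL : Finsler.IsLandsberg F)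
    (a b : TangentBundle (𝓡 n) M → ℝ) (δ : ℝ) (f : M ≃ₘ^∞⟮𝓡 n, 𝓡 n⟯ M)
    (P : OpenPartialHomeomorph M (EuclideanSpace ℝ (Fin n)) →
      EuclideanSpace ℝ (Fin n) → Fin n → Fin n → ℝ)
    (hP : Finsler.IsSymTensorDensity δ P) :
    ∀ φ ∈ IsManifold.maximalAtlas (𝓡 n) ∞ M, ∀ x ∈ φ.target,
      ∀ y : EuclideanSpace ℝ (Fin n), y ≠ 0 → ∀ k : Fin n,
        Finsler.chernOp F a b δ f P φ (x, y) k = Finsler.berwaldOp F a b δ f P φ (x, y) k := by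
  intro φ hφ x hx y hy k
  have hφ' := Finsler.symm_trans_mem_maximalAtlas f hφ
  have hp : (x, y) ∈ Finsler.slit φ.target := ⟨hx, hy⟩
  -- The coordinates do not change under pull-back: `φ ∘ f⁻¹` has the same target as `φ`.
  have hp' : (x, y) ∈ Finsler.slit
      (f.symm.toHomeomorph.toOpenPartialHomeomorph.trans φ).target := ⟨by simpa using hx, hy⟩
  apply Finsler.cocycleOp_congr
  · exact hF.chern_eq_berwald hL hφ hp
  · exact hF.chern_eq_berwald hL hφ' hp'
  · exact hF.chernB_eq_berwaldB _ _ hφ hp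
  · exact hF.chernB_eq_berwaldB _ _ hφ' hp'
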